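/- Let $X$ be a topological space (no separation axioms are assumed). An open cover of $X$ is a set of open subsets of $X$ with union $X$; an $\omega$-cover of $X$ is an open cover $\mathscr U$ such that every finite subset of $X$ is contained in some member of $\mathscr U$. Let $\mathcal O_X$ and $\Omega_X$ be the collections of all open covers and of all $\omega$-covers of $X$. For collections $\mathcal A,\mathcal B$ of sets, in the game $\mathsf G_{\mathrm{fin}}(\mathcal A,\mathcal B)$ (resp. $\mathsf G_1(\mathcal A,\mathcal B)$) in each round $n\in\omega$ Player 1 plays $A_n\in\mathcal A$ and Player 2 answers with a finite set $\mathscr F_n\subseteq A_n$ (resp. an element $x_n\in A_n$); Player 2 wins if $\bigcup_n\mathscr F_n\in\mathcal B$ (resp. $\{x_n:n\in\omega\}\in\mathcal B$). The space $X$ is strategically Menger, strategically $\omega$-Menger, strategically Rothberger, or strategically $\omega$-Rothberger if Player 2 has a winning (full-information) strategy in $\mathsf G_{\mathrm{fin}}(\mathcal O_X,\mathcal O_X)$, $\mathsf G_{\mathrm{fin}}(\Omega_X,\Omega_X)$, $\mathsf G_1(\mathcal O_X,\mathcal O_X)$, or $\mathsf G_1(\Omega_X,\Omega_X)$, respectively.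 Then: (1) $X$ is strategically $\omega$-Menger if and only if it is strategically Menger. (2) If $X$ is non-empty, then $X$ is strategically $\omega$-Rothberger if and only if it is strategically Rothberger. -/

import Mathlib

/-- The collection of all open covers of `X`; a cover is a set of open subsets of `X`. -/
def openCovers (X : Type*) [TopologicalSpace X] : Set (Set (Set X)) :=
  {𝒰 | (∀ U ∈ 𝒰, IsOpen U) ∧ ⋃₀ 𝒰 = Set.univ}

/-- The collection of all `ω`-covers of `X`: open covers such that every finite subset of `X` is
contained in a single member. -/
def omegaCovers (X : Type*) [TopologicalSpace X] : Set (Set (Set X)) :=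
  {𝒰 | 𝒰 ∈ openCovers X ∧ ∀ F : Set X, F.Finite → ∃ U ∈ 𝒰, F ⊆ U}

/-- Player 2 has a winning strategy in the single-selection game `G₁(𝒜, ℬ)`: in round `n`
Player 1 plays `A n ∈ 𝒜`, Player 2 answers with an element of `A n`, and Player 2 wins when the
set of all answers belongs to `ℬ`. The answer `σ n s` in round `n` may depend on all of the moves
`s 0, …, s n` made so far by Player 1. -/
def P2WinsSingle {α : Type*} (𝒜 ℬ : Set (Set α)) : Prop :=
  ∃ σ : (n : ℕ) → (Fin (n + 1) → 𝒜) → α,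
    (∀ (n : ℕ) (s : Fin (n + 1) → 𝒜), σ n s ∈ (s (Fin.last n) : Set α)) ∧
    ∀ A : ℕ → 𝒜, Set.range (fun n : ℕ => σ n (fun i => A i)) ∈ ℬ

/-- Player 2 has a winning strategy in the finite-selection game `G_fin(𝒜, ℬ)`: in round `n`
Player 1 plays `A n ∈ 𝒜`, Player 2 answers with a finite subset of `A n`, and Player 2 wins when
the union of all answers belongs to `ℬ`. -/
def P2WinsFin {α : Type*} (𝒜 ℬ : Set (Set α)) : Prop :=
  ∃ σ : (n : ℕ) → (Fin (n + 1) → 𝒜) → Finset α,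
    (∀ (n : ℕ) (s : Fin (n + 1) → 𝒜), (σ n s : Set α) ⊆ (s (Fin.last n) : Set α)) ∧
    ∀ A : ℕ → 𝒜, (⋃ n : ℕ, (σ n (fun i => A i) : Set α)) ∈ ℬ

def StrategicallyMenger (X : Type*) [TopologicalSpace X] : Prop :=
  P2WinsFin (openCovers X) (openCovers X)

def StrategicallyOmegaMenger (X : Type*) [TopologicalSpace X] : Prop :=
  P2WinsFin (omegaCovers X) (omegaCovers X)

def StrategicallyRothberger (X : Type*) [TopologicalSpace X] : Prop :=
  P2WinsSingle (openCovers X) (openCovers X)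

def StrategicallyOmegaRothberger (X : Type*) [TopologicalSpace X] : Prop :=
  P2WinsSingle (omegaCovers X) (omegaCovers X)

open Filter

/-! ### Strategies that read the history as a list -/

/-! The device behind both hard directions is to answer every sublist of the history: if a point
were missed infinitely often, the missed rounds would form a losing run of the original strategy. So
winning improves to covering each point in all but finitely many rounds. Menger: finite unions turn
a cover into an `ω`-cover, giving one direction. Conversely, `exists_eventuallySelects_succ` builds
by induction on `m` a strategy that eventually catches every `m`-point set, and these are then run
together. Rothberger: Galvin's duality passes to the player who names points (or finite sets)
against open neighbourhoods. There, points become finite sets by naming the targets of all sublists,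
and a finite set is named point by point, its neighbourhoods being joined. -/

theorem exists_list_strategy {γ β : Type*} (σ : (n : ℕ) → (Fin (n + 1) → γ) → β) :
    ∃ τ : List γ → γ → β,
      (∀ l a, ∃ n, ∃ s : Fin (n + 1) → γ, s (Fin.last n) = a ∧ τ l a = σ n s) ∧
      ∀ (A : ℕ → γ) (n : ℕ), τ ((List.range n).map A) (A n) = σ n (fun i => A i) := by
  refine ⟨fun l a => σ l.length (fun i => (l ++ [a]).getD i a), fun l a =>
    ⟨l.length, fun i => (l ++ [a]).getD i a, by simp, rfl⟩, fun A n => ?_⟩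
  have key : ∀ k, k = n → σ k (fun i => ((List.range n).map A ++ [A n]).getD i (A n)) =
      σ n (fun i => A i) := by
    rintro k rfl
    congr 1
    funext i
    have h : (List.range k).map A ++ [A k] = (List.range (k + 1)).map A := by
      simp [List.range_succ]
    rw [h, List.getD_eq_getElem _ _ (by simpa using Nat.le_of_lt_succ i.isLt)]
    simp
  exact key _ (by simp)

theorem exists_fin_strategy {γ β : Type*} (τ : List γ → γ → β) :
    ∃ σ : (n : ℕ) → (Fin (n + 1) → γ) → β,
      (∀ n s, ∃ l, σ n s = τ l (s (Fin.last n))) ∧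
      ∀ (A : ℕ → γ) (n : ℕ), σ n (fun i => A i) = τ ((List.range n).map A) (A n) := by
  refine ⟨fun n s => τ (List.ofFn fun i : Fin n => s i.castSucc) (s (Fin.last n)),
    fun n s => ⟨_, rfl⟩, fun A n => ?_⟩
  have h : (List.ofFn fun i : Fin n => A i) = (List.range n).map A :=
    List.ext_getElem (by simp) fun i h₁ h₂ => by simp
  exact congrArg (τ · (A n)) h

theorem p2WinsFin_iff_list {α : Type*} {𝒜 ℬ : Set (Set α)} :
    P2WinsFin 𝒜 ℬ ↔ ∃ τ : List 𝒜 → 𝒜 → Finset α, (∀ l (A : 𝒜), (τ l A : Set α) ⊆ A) ∧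
      ∀ A : ℕ → 𝒜, (⋃ n : ℕ, (τ ((List.range n).map A) (A n) : Set α)) ∈ ℬ := by
  constructor
  · rintro ⟨σ, hσ, hwin⟩
    obtain ⟨τ, h₁, h₂⟩ := exists_list_strategy σ
    refine ⟨τ, fun l A => ?_, fun A => by simpa only [h₂] using hwin A⟩
    obtain ⟨n, s, rfl, h⟩ := h₁ l A
    exact h ▸ hσ n s
  · rintro ⟨τ, hτ, hwin⟩
    obtain ⟨σ, h₁, h₂⟩ := exists_fin_strategy τ
    refine ⟨σ, fun n s => ?_, fun A => by simpa only [h₂] using hwin A⟩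
    obtain ⟨l, h⟩ := h₁ n s
    exact h ▸ hτ l _

theorem p2WinsSingle_iff_list {α : Type*} {𝒜 ℬ : Set (Set α)} :
    P2WinsSingle 𝒜 ℬ ↔ ∃ τ : List 𝒜 → 𝒜 → α, (∀ l (A : 𝒜), τ l A ∈ (A : Set α)) ∧
      ∀ A : ℕ → 𝒜, Set.range (fun n : ℕ => τ ((List.range n).map A) (A n)) ∈ ℬ := by
  constructor
  · rintro ⟨σ, hσ, hwin⟩
    obtain ⟨τ, h₁, h₂⟩ := exists_list_strategy σ
    refine ⟨τ, fun l A => ?_, fun A => by simpa only [h₂] using hwin A⟩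
    obtain ⟨n, s, rfl, h⟩ := h₁ l A
    exact h ▸ hσ n s
  · rintro ⟨τ, hτ, hwin⟩
    obtain ⟨σ, h₁, h₂⟩ := exists_fin_strategy τ
    refine ⟨σ, fun n s => ?_, fun A => by simpa only [h₂] using hwin A⟩
    obtain ⟨l, h⟩ := h₁ n s
    exact h ▸ hτ l _

theorem StrictMono.map_range_sublist {φ : ℕ → ℕ} (hφ : StrictMono φ) (k : ℕ) :
    ((List.range k).map φ).Sublist (List.range (φ k)) := by
  induction k with
  | zero => simp
  | succ k ih =>
    have h₁ : ((List.range (k + 1)).map φ).Sublist (List.range (φ k + 1)) := by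
      rw [List.range_succ, List.range_succ, List.map_append]
      exact ih.append (by simp)
    exact h₁.trans (List.range_sublist.2 (hφ (Nat.lt_succ_self k)))

theorem StrictMono.map_comp_range_sublist {γ : Type*} {φ : ℕ → ℕ} (hφ : StrictMono φ)
    (A : ℕ → γ) (k : ℕ) :
    ((List.range k).map (A ∘ φ)).Sublist ((List.range (φ k)).map A) := by
  rw [← List.map_map]
  exact (hφ.map_range_sublist k).map A

/-! ### Covers -/

section Covers

variable {X : Type*} [TopologicalSpace X]

theorem mem_omegaCovers_iff {𝒰 : Set (Set X)} :
    𝒰 ∈ omegaCovers X ↔ (∀ U ∈ 𝒰, IsOpen U) ∧ ∀ F : Finset X, ∃ U ∈ 𝒰, (F : Set X) ⊆ U := by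
  constructor
  · rintro ⟨⟨ho, -⟩, h⟩
    exact ⟨ho, fun F => h _ F.finite_toSet⟩
  · rintro ⟨ho, h⟩
    refine ⟨⟨ho, Set.eq_univ_of_forall fun x => ?_⟩, fun F hF => ?_⟩
    · obtain ⟨U, hU, hx⟩ := h {x}
      exact ⟨U, hU, hx (by simp)⟩
    · simpa using h hF.toFinset

theorem mem_openCovers_iff {𝒰 : Set (Set X)} :
    𝒰 ∈ openCovers X ↔ (∀ U ∈ 𝒰, IsOpen U) ∧ ∀ x : X, ∃ U ∈ 𝒰, x ∈ U := by
  simp [openCovers, Set.eq_univ_iff_forall]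

/-- The finite unions of members of a family of sets. -/
def finiteUnions (𝒰 : Set (Set X)) : Set (Set X) :=
  {D | ∃ G : Finset (Set X), (G : Set (Set X)) ⊆ 𝒰 ∧ D = ⋃₀ (G : Set (Set X))}

theorem finiteUnions_mem_omegaCovers {𝒰 : Set (Set X)} (h : 𝒰 ∈ openCovers X) :
    finiteUnions 𝒰 ∈ omegaCovers X := by
  classical
  rw [mem_openCovers_iff] at h
  rw [mem_omegaCovers_iff]
  refine ⟨?_, fun F => ?_⟩
  · rintro _ ⟨G, hG, rfl⟩
    exact isOpen_sUnion fun U hU => h.1 U (hG hU)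
  · choose f hf hx using h.2
    refine ⟨_, ⟨F.image f, ?_, rfl⟩, fun x hxF => ⟨f x, ?_, hx x⟩⟩
    · intro U hU
      obtain ⟨x, -, rfl⟩ := Finset.mem_image.1 hU
      exact hf x
    · exact Finset.mem_coe.2 (Finset.mem_image_of_mem f hxF)

/-- The members of an `ω`-cover that contain a given point again form an `ω`-cover. -/
def restrictAt (𝒲 : omegaCovers X) (x : X) : omegaCovers X :=
  ⟨{W ∈ (𝒲 : Set (Set X)) | x ∈ W}, by
    classical
    have h := mem_omegaCovers_iff.1 𝒲.2
    refine mem_omegaCovers_iff.2 ⟨fun U hU => h.1 U hU.1, fun F => ?_⟩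
    obtain ⟨U, hU, hF⟩ := h.2 (insert x F)
    exact ⟨U, ⟨hU, hF (by simp)⟩, fun y hy => hF (by simp_all)⟩⟩

/-! ### The finite-selection games -/

theorem StrategicallyOmegaMenger.strategicallyMenger (h : StrategicallyOmegaMenger X) :
    StrategicallyMenger X := by
  classical
  obtain ⟨σ, hσ, hwin⟩ := h
  let D : openCovers X → omegaCovers X := fun 𝒰 => ⟨_, finiteUnions_mem_omegaCovers 𝒰.2⟩
  have hG : ∀ (𝒰 : openCovers X) (V : Set X), ∃ G : Finset (Set X),
      (G : Set (Set X)) ⊆ 𝒰 ∧ (V ∈ finiteUnions (𝒰 : Set (Set X)) → V = ⋃₀ (G : Set (Set X))) := by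
    intro 𝒰 V
    by_cases hV : V ∈ finiteUnions (𝒰 : Set (Set X))
    · obtain ⟨G, h₁, h₂⟩ := hV
      exact ⟨G, h₁, fun _ => h₂⟩
    · exact ⟨∅, by simp, fun h => (hV h).elim⟩
  choose G hG₁ hG₂ using hG
  have hsub : ∀ (n : ℕ) (s : Fin (n + 1) → openCovers X),
      (((σ n (D ∘ s)).biUnion (G (s (Fin.last n))) : Finset (Set X)) : Set (Set X)) ⊆
        (s (Fin.last n) : Set (Set X)) := by
    intro n s U hU
    obtain ⟨V, -, hV⟩ := Finset.mem_biUnion.1 (Finset.mem_coe.1 hU)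
    exact hG₁ _ V hV
  refine ⟨fun n s => (σ n (D ∘ s)).biUnion (G (s (Fin.last n))), hsub, fun A => ?_⟩
  rw [mem_openCovers_iff]
  constructor
  · intro U hU
    obtain ⟨n, hn⟩ := Set.mem_iUnion.1 hU
    exact (A n).2.1 U (hsub n (fun i => A i) hn)
  · intro x
    obtain ⟨V, hV, hx⟩ := (mem_openCovers_iff.1 (hwin fun n => D (A n)).1).2 x
    obtain ⟨n, hn⟩ := Set.mem_iUnion.1 hV
    have hVD : V ∈ finiteUnions (A n : Set (Set X)) := hσ n (fun i => D (A i)) hn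
    rw [hG₂ (A n) V hVD] at hx
    obtain ⟨U, hU, hxU⟩ := hx
    exact ⟨U, Set.mem_iUnion.2 ⟨n, Finset.mem_coe.2 (Finset.mem_biUnion.2 ⟨V, hn, hU⟩)⟩, hxU⟩

/-- Answering all sublists of the history at once, a winning strategy in the Menger game can be
improved so that each point is covered in all but finitely many rounds. -/
theorem StrategicallyMenger.exists_eventually (h : StrategicallyMenger X) :
    ∃ τ : List (openCovers X) → openCovers X → Finset (Set X),
      (∀ l 𝒰, (τ l 𝒰 : Set (Set X)) ⊆ 𝒰) ∧
      ∀ (A : ℕ → openCovers X) (x : X),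
        ∀ᶠ n in atTop, ∃ U ∈ τ ((List.range n).map A) (A n), x ∈ U := by
  classical
  obtain ⟨σ, hσ, hwin⟩ := p2WinsFin_iff_list.1 h
  refine ⟨fun l 𝒰 => l.sublists.toFinset.biUnion fun s => σ s 𝒰, fun l 𝒰 U hU => ?_,
    fun A x => ?_⟩
  · obtain ⟨s, -, hs⟩ := Finset.mem_biUnion.1 (Finset.mem_coe.1 hU)
    exact hσ s 𝒰 hs
  -- Along the failing rounds `φ`, `A ∘ φ` is a run that `σ` wins, and its histories are sublists of
  -- the true ones.
  · by_contra hcon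
    obtain ⟨φ, hφ, hfail⟩ := extraction_of_frequently_atTop (not_eventually.1 hcon)
    obtain ⟨U, hU, hx⟩ := (mem_openCovers_iff.1 (hwin (A ∘ φ))).2 x
    obtain ⟨k, hk⟩ := Set.mem_iUnion.1 hU
    refine hfail k ⟨U, Finset.mem_biUnion.2 ⟨_, ?_, hk⟩, hx⟩
    simpa using hφ.map_comp_range_sublist A k

/-- Strategies in the game played on `ω`-covers for which each set of `m` points is contained in a
selected member in all but finitely many rounds. -/
def EventuallySelects (m : ℕ) (τ : List (omegaCovers X) → omegaCovers X → Finset (Set X)) : Prop :=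
  (∀ l 𝒲, (τ l 𝒲 : Set (Set X)) ⊆ 𝒲) ∧
    ∀ (A : ℕ → omegaCovers X) (F : Finset X), F.card = m →
      ∀ᶠ n in atTop, ∃ U ∈ τ ((List.range n).map A) (A n), (F : Set X) ⊆ U

theorem exists_eventuallySelects_zero :
    ∃ τ : List (omegaCovers X) → omegaCovers X → Finset (Set X), EventuallySelects 0 τ := by
  choose f hf _ using fun 𝒲 : omegaCovers X => (mem_omegaCovers_iff.1 𝒲.2).2 ∅
  refine ⟨fun _ 𝒲 => {f 𝒲}, fun l 𝒲 => by simpa using hf 𝒲, fun A F hF => ?_⟩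
  obtain rfl := Finset.card_eq_zero.1 hF
  exact Eventually.of_forall fun n => ⟨_, Finset.mem_singleton_self _, by simp⟩

section Insert

variable (τ : List (omegaCovers X) → omegaCovers X → Finset (Set X))

/-- The common part of all answers of `τ` to the members of `𝒲` around `x`, over the finite set
`T` of histories. -/
def answerNhd (T : Finset (List (omegaCovers X))) (𝒲 : omegaCovers X) (x : X) : Set X :=
  ⋂ h ∈ T, ⋂ W ∈ τ h (restrictAt 𝒲 x), W

variable {τ}

theorem range_answerNhd_mem (hτ : ∀ l 𝒲, (τ l 𝒲 : Set (Set X)) ⊆ 𝒲)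
    (T : Finset (List (omegaCovers X))) (𝒲 : omegaCovers X) :
    Set.range (answerNhd τ T 𝒲) ∈ openCovers X := by
  rw [mem_openCovers_iff]
  constructor
  · rintro _ ⟨x, rfl⟩
    refine isOpen_biInter_finset fun h _ => isOpen_biInter_finset fun W hW => ?_
    exact (restrictAt 𝒲 x).2.1.1 W (hτ _ _ hW)
  · refine fun x => ⟨_, ⟨x, rfl⟩, ?_⟩
    simp only [answerNhd, Set.mem_iInter]
    exact fun h _ W hW => (hτ h _ hW).2

end Insert

/-- To catch `insert x F`, let `σ` cover `x` by some `answerNhd` of a point `p`. Every answer of `τ`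
to the restriction at `p`, for each stored history, then contains `x`, and `τ` eventually catches
`F` in one of them. -/
theorem exists_eventuallySelects_succ (hX : StrategicallyMenger X) {m : ℕ}
    {τ : List (omegaCovers X) → omegaCovers X → Finset (Set X)} (hτ : EventuallySelects m τ) :
    ∃ τ' : List (omegaCovers X) → omegaCovers X → Finset (Set X),
      EventuallySelects (m + 1) τ' := by
  classical
  obtain ⟨σ, hσ, hev⟩ := hX.exists_eventually
  let cov : Finset (List (omegaCovers X)) → omegaCovers X → openCovers X :=
    fun T 𝒲 => ⟨_, range_answerNhd_mem hτ.1 T 𝒲⟩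
  have hpts : ∀ (P : List (openCovers X)) (T : Finset (List (omegaCovers X))) (𝒲 : omegaCovers X),
      ∃ p : Finset X, σ P (cov T 𝒲) = p.image (answerNhd τ T 𝒲) := by
    intro P T 𝒲
    obtain ⟨p, -, hp⟩ := Finset.subset_set_image_iff.1
      (show (σ P (cov T 𝒲) : Set (Set X)) ⊆ answerNhd τ T 𝒲 '' Set.univ by
        rw [Set.image_univ]; exact hσ P (cov T 𝒲))
    exact ⟨p, hp.symm⟩
  choose pts hpts using hpts
  -- The state holds the covers shown to `σ` and a finite tree of histories for `τ`. A branch grows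
  -- by the restriction at any selected point, or by `𝒲` itself for rounds where `x` is not covered.
  let step : List (openCovers X) × Finset (List (omegaCovers X)) → omegaCovers X →
      List (openCovers X) × Finset (List (omegaCovers X)) := fun S 𝒲 =>
    (S.1 ++ [cov S.2 𝒲],
      S.2.biUnion fun h => (insert 𝒲 ((pts S.1 S.2 𝒲).image (restrictAt 𝒲))).image (h ++ [·]))
  let state : List (omegaCovers X) → List (openCovers X) × Finset (List (omegaCovers X)) :=
    fun l => l.foldl step ([], {[]})
  refine ⟨fun l 𝒲 => (state l).2.biUnion fun h =>
    (pts (state l).1 (state l).2 𝒲).biUnion fun x => τ h (restrictAt 𝒲 x), ?_, ?_⟩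
  · intro l 𝒲 U hU
    simp only [Finset.coe_biUnion, Set.mem_iUnion] at hU
    obtain ⟨h, -, x, -, hU⟩ := hU
    exact (hτ.1 h _ hU).1
  · intro A F' hF'
    obtain ⟨x, F, -, rfl, hF⟩ := Finset.card_eq_succ.1 hF'
    let S : ℕ → List (openCovers X) × Finset (List (omegaCovers X)) :=
      fun n => state ((List.range n).map A)
    have hS : ∀ n, S (n + 1) = step (S n) (A n) := fun n => by
      simp [S, state, List.range_succ]
    have hS₁ : ∀ n, (S n).1 = (List.range n).map fun k => cov (S k).2 (A k) := by
      intro n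
      induction n with
      | zero => rfl
      | succ n ih => rw [hS, List.range_succ, List.map_append, ← ih]; rfl
    -- `B` is the branch of the tree that follows `x`.
    have hB : ∀ n, ∃ B : omegaCovers X,
        B ∈ insert (A n) ((pts (S n).1 (S n).2 (A n)).image (restrictAt (A n))) ∧
        ((∃ U ∈ σ (S n).1 (cov (S n).2 (A n)), x ∈ U) →
          ∃ p ∈ pts (S n).1 (S n).2 (A n), B = restrictAt (A n) p ∧
            x ∈ answerNhd τ (S n).2 (A n) p) := by
      intro n
      by_cases hx : ∃ U ∈ σ (S n).1 (cov (S n).2 (A n)), x ∈ U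
      · obtain ⟨U, hU, hx⟩ := hx
        rw [hpts] at hU
        obtain ⟨p, hp, rfl⟩ := Finset.mem_image.1 hU
        exact ⟨restrictAt (A n) p, Finset.mem_insert_of_mem (Finset.mem_image_of_mem _ hp),
          fun _ => ⟨p, hp, rfl, hx⟩⟩
      · exact ⟨A n, Finset.mem_insert_self _ _, fun h => (hx h).elim⟩
    choose B hB₁ hB₂ using hB
    have hT : ∀ n, (List.range n).map B ∈ (S n).2 := by
      intro n
      induction n with
      | zero => simp [S, state]
      | succ n ih =>
        rw [hS]
        refine Finset.mem_biUnion.2 ⟨_, ih, Finset.mem_image.2 ⟨B n, hB₁ n, ?_⟩⟩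
        simp [List.range_succ]
    filter_upwards [hev (fun k => cov (S k).2 (A k)) x, hτ.2 B F hF] with n hx hn
    rw [← hS₁] at hx
    obtain ⟨p, hp, hBp, hxp⟩ := hB₂ n hx
    obtain ⟨W, hW, hFW⟩ := hn
    rw [hBp] at hW
    refine ⟨W, Finset.mem_biUnion.2 ⟨_, hT n, Finset.mem_biUnion.2 ⟨p, hp, hW⟩⟩, ?_⟩
    rw [Finset.coe_insert, Set.insert_subset_iff]
    refine ⟨?_, hFW⟩
    simp only [answerNhd, Set.mem_iInter] at hxp
    exact hxp _ (hT n) W hW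

theorem StrategicallyMenger.strategicallyOmegaMenger (h : StrategicallyMenger X) :
    StrategicallyOmegaMenger X := by
  classical
  have hex : ∀ m, ∃ τ : List (omegaCovers X) → omegaCovers X → Finset (Set X),
      EventuallySelects m τ := by
    intro m
    induction m with
    | zero => exact exists_eventuallySelects_zero
    | succ m ih => exact exists_eventuallySelects_succ h ih.choose_spec
  choose τ hτ using hex
  -- Round `n` uses only `m ≤ n`, keeping answers finite; eventual selection makes the late start
  -- harmless.
  have hsub : ∀ l (𝒲 : omegaCovers X),
      (((Finset.range (l.length + 1)).biUnion fun m => τ m l 𝒲 : Finset (Set X)) :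
        Set (Set X)) ⊆ 𝒲 := by
    intro l 𝒲 U hU
    obtain ⟨m, -, hm⟩ := Finset.mem_biUnion.1 (Finset.mem_coe.1 hU)
    exact (hτ m).1 l 𝒲 hm
  refine p2WinsFin_iff_list.2 ⟨_, hsub, fun A => mem_omegaCovers_iff.2 ⟨fun U hU => ?_,
    fun F => ?_⟩⟩
  · obtain ⟨n, hn⟩ := Set.mem_iUnion.1 hU
    exact (A n).2.1.1 U (hsub _ _ hn)
  · obtain ⟨n, ⟨U, hU, hF⟩, hn⟩ :=
      (((hτ F.card).2 A F rfl).and (eventually_ge_atTop F.card)).exists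
    refine ⟨U, Set.mem_iUnion.2 ⟨n, Finset.mem_coe.2 (Finset.mem_biUnion.2 ⟨F.card, ?_, hU⟩)⟩, hF⟩
    simpa using Nat.lt_succ_of_le hn

end Covers

/-! ### The single-selection games -/

/-- Galvin's duality, first half: from a winning strategy in the single-selection game, a winning
strategy for the player who names targets `i : ι` against answers in `N i`. -/
theorem P2WinsSingle.exists_targets {α ι : Type*} {𝒜 ℬ : Set (Set α)} (N : ι → Set α)
    (hN : ∀ f : ι → α, (∀ i, f i ∈ N i) → Set.range f ∈ 𝒜) (h : P2WinsSingle 𝒜 ℬ) :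
    ∃ t : List α → ι, ∀ U : ℕ → α, (∀ n, U n ∈ N (t ((List.range n).map U))) →
      Set.range U ∈ ℬ := by
  classical
  obtain ⟨σ, hσ, hwin⟩ := p2WinsSingle_iff_list.1 h
  have hpt : ∀ l, ∃ i, ∀ U ∈ N i, ∃ A, σ l A = U := by
    intro l
    -- Otherwise each `N i` has a member `f i` that is never an answer after `l`, yet the answer to
    -- `Set.range f` is some `f i`.
    by_contra! hcon
    choose f hf hne using hcon
    obtain ⟨i, hi⟩ := hσ l ⟨_, hN f hf⟩
    exact hne i ⟨_, hN f hf⟩ hi.symm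
  choose i hi using hpt
  by_cases hne : Nonempty 𝒜
  swap
  · refine ⟨fun _ => i [], fun U hU => ?_⟩
    obtain ⟨A, -⟩ := hi [] _ (hU 0)
    exact (hne ⟨A⟩).elim
  have hcov : ∀ l U, ∃ A : 𝒜, U ∈ N (i l) → σ l A = U := by
    intro l U
    by_cases hU : U ∈ N (i l)
    · obtain ⟨A, hA⟩ := hi l U hU
      exact ⟨A, fun _ => hA⟩
    · exact ⟨hne.some, fun h => (hU h).elim⟩
  choose cov hcov using hcov
  let hist : List α → List 𝒜 := fun l => l.foldl (fun h U => h ++ [cov h U]) []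
  refine ⟨fun l => i (hist l), fun U hU => ?_⟩
  have hh : ∀ n, hist ((List.range n).map U) =
      (List.range n).map fun k => cov (hist ((List.range k).map U)) (U k) := by
    intro n
    induction n with
    | zero => rfl
    | succ n ih =>
      conv_rhs => rw [List.range_succ, List.map_append, ← ih]
      simp [hist, List.range_succ]
  convert hwin (fun k => cov (hist ((List.range k).map U)) (U k)) using 2
  funext n
  rw [← hh]
  exact (hcov _ _ (hU n)).symm

/-- Galvin's duality, second half. -/
theorem p2WinsSingle_of_targets {α ι : Type*} {𝒜 ℬ : Set (Set α)} (N : ι → Set α)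
    (hN : ∀ A ∈ 𝒜, ∀ i, ∃ U ∈ A, U ∈ N i) (t : List α → ι)
    (ht : ∀ U : ℕ → α, (∀ n, U n ∈ N (t ((List.range n).map U))) → Set.range U ∈ ℬ) :
    P2WinsSingle 𝒜 ℬ := by
  choose f hfA hfN using fun A : 𝒜 => hN A A.2
  let hist : List 𝒜 → List α := fun l => l.foldl (fun h A => h ++ [f A (t h)]) []
  refine p2WinsSingle_iff_list.2 ⟨fun l A => f A (t (hist l)), fun l A => hfA _ _, fun A => ?_⟩
  have hh : ∀ n, hist ((List.range n).map A) =
      (List.range n).map fun k => f (A k) (t (hist ((List.range k).map A))) := by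
    intro n
    induction n with
    | zero => rfl
    | succ n ih =>
      conv_rhs => rw [List.range_succ, List.map_append, ← ih]
      simp [hist, List.range_succ]
  refine ht _ fun n => ?_
  rw [← hh]
  exact hfN _ _

section Covers

variable {X : Type*} [TopologicalSpace X]

theorem StrategicallyRothberger.strategicallyOmegaRothberger
    (h : StrategicallyRothberger X) : StrategicallyOmegaRothberger X := by
  classical
  obtain ⟨t, ht⟩ := h.exists_targets (fun x : X => {U | IsOpen U ∧ x ∈ U}) fun f hf =>
    mem_openCovers_iff.2 ⟨by rintro _ ⟨x, rfl⟩; exact (hf x).1, fun x => ⟨_, ⟨x, rfl⟩, (hf x).2⟩⟩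
  refine p2WinsSingle_of_targets (fun F : Finset X => {U | IsOpen U ∧ (F : Set X) ⊆ U})
    (fun A hA F => ?_) (fun l => (l.sublists.map t).toFinset) fun U hU => ?_
  · obtain ⟨U, hU, hF⟩ := (mem_omegaCovers_iff.1 hA).2 F
    exact ⟨U, hU, hA.1.1 U hU, hF⟩
  · have hev : ∀ x, ∀ᶠ n in atTop, x ∈ U n := by
      intro x
      by_contra hcon
      obtain ⟨φ, hφ, hfail⟩ := extraction_of_frequently_atTop (not_eventually.1 hcon)
      have hc := ht (U ∘ φ) fun k => ⟨(hU _).1, (hU (φ k)).2 ?_⟩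
      · obtain ⟨_, ⟨k, rfl⟩, hx⟩ := (mem_openCovers_iff.1 hc).2 x
        exact hfail k hx
      · simp only [List.coe_toFinset, List.mem_map, List.mem_sublists, Set.mem_ofPred_eq]
        exact ⟨_, hφ.map_comp_range_sublist U k, rfl⟩
    refine mem_omegaCovers_iff.2 ⟨by rintro _ ⟨n, rfl⟩; exact (hU n).1, fun F => ?_⟩
    obtain ⟨n, hn⟩ := ((eventually_all_finset F).2 fun x _ => hev x).exists
    exact ⟨U n, ⟨n, rfl⟩, fun x hx => hn x hx⟩

/-- The state of a play that asks for the points of finite sets one at a time: the list of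
completed blocks, the points still to be covered, and the union of the current block. -/
noncomputable def pointStep (t : List (Set X) → Finset X) :
    List (Set X) × List X × Set X → Set X → List (Set X) × List X × Set X
  | (h, _ :: y :: r, a), U => (h, y :: r, a ∪ U)
  | (h, _, a), U => (h ++ [a ∪ U], (t (h ++ [a ∪ U])).toList, ∅)

/-- A block ends with `V` the union of its moves. As `V` lies in `⋃ k, U k`, covering `X` by blocks
forces covering it by moves. -/
theorem exists_block (t : List (Set X) → Finset X) (x₀ : X) {U : ℕ → Set X}
    {S : ℕ → List (Set X) × List X × Set X} (hS : ∀ n, S (n + 1) = pointStep t (S n) (U n))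
    (hU : ∀ n, IsOpen (U n)) (hmem : ∀ n, (S n).2.1.headD x₀ ∈ U n) (p : List X) :
    ∀ (n : ℕ) (h : List (Set X)) (a : Set X), IsOpen a → a ⊆ ⋃ k, U k → S n = (h, p, a) →
      ∃ m V, IsOpen V ∧ V ⊆ ⋃ k, U k ∧ a ⊆ V ∧ (∀ x ∈ p, x ∈ V) ∧
        S m = (h ++ [V], (t (h ++ [V])).toList, ∅) := by
  have hcup : ∀ {n a}, a ⊆ ⋃ k, U k → a ∪ U n ⊆ ⋃ k, U k := fun ha =>
    Set.union_subset ha (Set.subset_iUnion U _)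
  induction p with
  | nil =>
    -- An empty target still costs one round, in which the dummy point `x₀` is named; hence the need
    -- for `X` to be non-empty.
    intro n h a ha hsub hn
    exact ⟨n + 1, a ∪ U n, ha.union (hU n), hcup hsub, Set.subset_union_left, by simp,
      by rw [hS, hn]; rfl⟩
  | cons x p ih =>
    intro n h a ha hsub hn
    have hx : x ∈ U n := by simpa [hn] using hmem n
    cases p with
    | nil =>
      exact ⟨n + 1, a ∪ U n, ha.union (hU n), hcup hsub, Set.subset_union_left, by simp [hx],
        by rw [hS, hn]; rfl⟩
    | cons y r =>
      obtain ⟨m, V, hV, hVU, haV, hyV, hm⟩ := ih (n + 1) h (a ∪ U n) (ha.union (hU n))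
        (hcup hsub) (by rw [hS, hn]; rfl)
      refine ⟨m, V, hV, hVU, Set.subset_union_left.trans haV, ?_, hm⟩
      intro z hz
      rcases List.mem_cons.1 hz with rfl | hz
      · exact haV (Or.inr hx)
      · exact hyV z hz

theorem StrategicallyOmegaRothberger.strategicallyRothberger [Nonempty X]
    (h : StrategicallyOmegaRothberger X) : StrategicallyRothberger X := by
  obtain ⟨x₀⟩ := ‹Nonempty X›
  obtain ⟨t, ht⟩ := h.exists_targets (fun F : Finset X => {U | IsOpen U ∧ (F : Set X) ⊆ U})
    fun f hf => mem_omegaCovers_iff.2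
      ⟨by rintro _ ⟨F, rfl⟩; exact (hf F).1, fun F => ⟨_, ⟨F, rfl⟩, (hf F).2⟩⟩
  let state : List (Set X) → List (Set X) × List X × Set X :=
    fun l => l.foldl (pointStep t) ([], (t []).toList, ∅)
  refine p2WinsSingle_of_targets (fun x : X => {U | IsOpen U ∧ x ∈ U})
    (fun A hA x => ?_) (fun l => (state l).2.1.headD x₀) fun U hU => ?_
  · obtain ⟨U, hU, hx⟩ := (mem_openCovers_iff.1 hA).2 x
    exact ⟨U, hU, hA.1 U hU, hx⟩
  · have hblock := exists_block t x₀ (U := U) (S := fun n => state ((List.range n).map U))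
      (fun n => by simp [state, List.range_succ]) (fun n => (hU n).1) (fun n => (hU n).2)
    let Good := {h : List (Set X) // ∃ n, state ((List.range n).map U) = (h, (t h).toList, ∅)}
    have hnext : ∀ g : Good, ∃ V, IsOpen V ∧ V ⊆ ⋃ k, U k ∧ (t g.1 : Set X) ⊆ V ∧
        ∃ n, state ((List.range n).map U) = (g.1 ++ [V], (t (g.1 ++ [V])).toList, ∅) := by
      rintro ⟨h, n, hn⟩
      obtain ⟨m, V, h₁, h₂, -, h₃, h₄⟩ := hblock _ n h ∅ isOpen_empty (Set.empty_subset _) hn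
      exact ⟨V, h₁, h₂, fun x hx => h₃ x (by simpa using hx), m, h₄⟩
    choose V hVo hVU hVt hV using hnext
    -- The successive blocks form a play against `t`.
    let g : ℕ → Good := fun n => Nat.rec ⟨[], 0, rfl⟩ (fun _ g => ⟨g.1 ++ [V g], hV g⟩) n
    have hg : ∀ n, (g n).1 = (List.range n).map fun k => V (g k) := by
      intro n
      induction n with
      | zero => rfl
      | succ n ih => rw [List.range_succ, List.map_append, ← ih]; rfl
    have hω := ht (fun k => V (g k)) fun n => ⟨hVo _, by rw [← hg]; exact hVt _⟩
    refine mem_openCovers_iff.2 ⟨by rintro _ ⟨n, rfl⟩; exact (hU n).1, fun x => ?_⟩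
    obtain ⟨_, ⟨k, rfl⟩, hx⟩ := (mem_openCovers_iff.1 hω.1).2 x
    obtain ⟨n, hn⟩ := Set.mem_iUnion.1 (hVU _ hx)
    exact ⟨U n, ⟨n, rfl⟩, hn⟩

end Covers

theorem mainTheorem5 (X : Type*) [TopologicalSpace X] :
    (StrategicallyOmegaMenger X ↔ StrategicallyMenger X) ∧
    (Nonempty X → (StrategicallyOmegaRothberger X ↔ StrategicallyRothberger X)) :=
  ⟨⟨fun h => h.strategicallyMenger, fun h => h.strategicallyOmegaMenger⟩,
    fun _ => ⟨fun h => h.strategicallyRothberger, fun h => h.strategicallyOmegaRothberger⟩⟩
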